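/- Let $\mathcal E$ be a finite-dimensional real inner product space with induced norm $\|\cdot\|$, and let $C_1,\dots,C_m\subseteq\mathcal E$ be closed convex sets with $C:=\bigcap_{i=1}^m C_i\neq\emptyset$. A function $\Phi:[0,\infty)\times[0,\infty)\to[0,\infty)$ is a \emph{strict consistent error bound function} for $C_1,\dots,C_m$ if 1. $\operatorname{dist}(x,C)\le\Phi\bigl(\max_{1\le i\le m}\operatorname{dist}(x,C_i),\|x\|\bigr)$ for all $x\in\mathcal E$; 2. for every $b\ge 0$, $\Phi(\cdot,b)$ is nondecreasing on $[0,\infty)$, right-continuous at $0$, and $\Phi(0,b)=0$; 3. for every $a\ge 0$, $\Phi(a,\cdot)$ is nondecreasing on $[0,\infty)$; 4. for every $b>0$, $\Phi(\cdot,b)$ is strictly increasing on $[0,\infty)$. For $\kappa>0$ put $\phi(t):=\Phi(\sqrt t,\kappa)^2$ for $t\ge 0$, $\phi^-(s):=\inf\{t\ge 0:\phi(t)\ge s\}$ for $0\le s<\sup\phi$, and $$\Phi_\kappa^\spadesuit(t):=\int_{c}^{t}\frac{ds}{\phi^-(s)},\qquad t\in(0,\sup\phi),$$ where $c\in(0,\sup\phi)$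 is an arbitrary fixed number. Let $\Psi(t):=-\Phi_\kappa^\spadesuit(1/t)$ for $t>0$ with $1/t<\sup\phi$. Inverses below are the inverses of these functions on these domains. A function $f$ is in $\mathrm{RV}$ with index $\rho\in\mathbb R$ if, on some $[a,\infty)$ with $a>0$, it is measurable and positive, and $\lim_{x\to\infty}f(\lambda x)/f(x)=\lambda^\rho$ for all $\lambda>0$. It is in $\mathrm{RV}^0$ with index $\rho$ if, on some $(0,a]$ with $a>0$, it is measurable and positive, and $\lim_{x\to0_+}f(\lambda x)/f(x)=\lambda^\rho$ for all $\lambda>0$. It is in $\mathrm{RV}_\infty$ if, on some $[a,\infty)$ with $a>0$, it is measurable and positive, and $\lim_{x\to\infty}f(\lambda x)/f(x)$ equals $0$, $1$, $+\infty$ for $\lambda\in(0,1)$, $\lambda=1$, $\lambda>1$, respectively. **Theorem.** Let $\Phi$ be a strict consistent error bound function for $C_1,\dots,C_m$. Suppose that $C\ne\mathcal E$ and that $\kappa\ge\max\{\operatorname{dist}(0,C),\|x^0\|\}$ for some $x^0\notin C$. Suppose also that $\Phi(\cdot,\kappa)$ is continuous and belongs to $\mathrm{RV}^0$ with index $\rho$.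 Then $\Phi_\kappa^\spadesuit$ is strictly increasing on $(0,\sup\phi)$ and takes the value $-s$ for all sufficiently large $s$ (so $(\Phi_\kappa^\spadesuit)^{-1}(-s)$ is well defined for such $s$), and: (i) $\rho\in[0,1]$. (ii) If $\rho\in(0,1)$, then $\Psi\in\mathrm{RV}$ with index $(1/\rho)-1$ and $\Psi^{-1}\in\mathrm{RV}$ with index $\rho/(1-\rho)$; and for every $\delta>0$ such that $\gamma:=\rho/(1-\rho)-\delta$ is positive, there are constants $M,A>0$ such that $$\sqrt{(\Phi_\kappa^\spadesuit)^{-1}(-s)}\le A\left(\frac1s\right)^{\gamma/2}\qquad\text{for all } s\ge M.$$ (iii) If $\rho=1$, then $\Psi\in\mathrm{RV}$ with index $0$ and $\Psi^{-1}\in\mathrm{RV}_\infty$; and for every $r>0$, $\sqrt{(\Phi_\kappa^\spadesuit)^{-1}(-s)}=o(s^{-r})$ as $s\to+\infty$. (iv) If $\rho=0$, then $\Psi\in\mathrm{RV}_\infty$ and $\Psi^{-1}\in\mathrm{RV}$ with index $0$; and for every $r>0$, $s^{-r}=o\bigl((\Phi_\kappa^\spadesuit)^{-1}(-s)\bigr)$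 as $s\to+\infty$. -/

import Mathlib

open Set Filter Topology Asymptotics

namespace ErrorBound

/-- `Φ : [0,∞) × [0,∞) → [0,∞)` is a consistent error bound function for the sets `C i`.
Values of `Φ` at negative arguments play no role. -/
structure IsConsistent {E : Type*} [NormedAddCommGroup E] {m : ℕ}
    (C : Fin m → Set E) (Φ : ℝ → ℝ → ℝ) : Prop where
  nonneg : ∀ a, 0 ≤ a → ∀ b, 0 ≤ b → 0 ≤ Φ a b
  error_bound : ∀ x : E,
    Metric.infDist x (⋂ i, C i) ≤ Φ (⨆ i, Metric.infDist x (C i)) ‖x‖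
  mono_left : ∀ b, 0 ≤ b → MonotoneOn (fun a => Φ a b) (Ici 0)
  right_continuous : ∀ b, 0 ≤ b → ContinuousWithinAt (fun a => Φ a b) (Ici 0) 0
  map_zero : ∀ b, 0 ≤ b → Φ 0 b = 0
  mono_right : ∀ a, 0 ≤ a → MonotoneOn (fun b => Φ a b) (Ici 0)

/-- Strict consistent error bound functions. -/
structure IsStrictConsistent {E : Type*} [NormedAddCommGroup E] {m : ℕ}
    (C : Fin m → Set E) (Φ : ℝ → ℝ → ℝ) : Prop extends IsConsistent C Φ where
  strict : ∀ b, 0 < b → StrictMonoOn (fun a => Φ a b) (Ici 0)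

/-- `φ_{κ,Φ}(t) = Φ(√t, κ)²` for `t ≥ 0`. -/
noncomputable def phi (Φ : ℝ → ℝ → ℝ) (κ t : ℝ) : ℝ := (Φ (Real.sqrt t) κ) ^ 2

/-- The generalized inverse `f⁻(s) = inf {t ≥ 0 : f t ≥ s}` of a function on `[0,∞)`. -/
noncomputable def genInv (f : ℝ → ℝ) (s : ℝ) : ℝ := sInf {t | 0 ≤ t ∧ s ≤ f t}

/-- The open interval `(0, sup φ_{κ,Φ})`, where the supremum over `[0,∞)` may be `+∞`:
`t < sup φ` means that some value of `φ` exceeds `t`. -/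
def dom (Φ : ℝ → ℝ → ℝ) (κ : ℝ) : Set ℝ := {t | 0 < t ∧ ∃ u, 0 ≤ u ∧ t < phi Φ κ u}

/-- The inverse smoothing function `Φ_κ^♠(t) = ∫_c^t ds / φ_{κ,Φ}⁻(s)`, `t ∈ (0, sup φ_{κ,Φ})`,
with base point `c`. -/
noncomputable def spade (Φ : ℝ → ℝ → ℝ) (κ c t : ℝ) : ℝ :=
  ∫ s in c..t, 1 / genInv (phi Φ κ) s

/-- The inverse of `Φ_κ^♠ : (0, sup φ_{κ,Φ}) → ℝ` (meaningful on the image of `Φ_κ^♠`). -/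
noncomputable def spadeInv (Φ : ℝ → ℝ → ℝ) (κ c : ℝ) : ℝ → ℝ :=
  Function.invFunOn (spade Φ κ c) (dom Φ κ)

/-- `Ψ(t) = -Φ_κ^♠(1/t)`, for `t > 0` with `1/t ∈ (0, sup φ_{κ,Φ})`. -/
noncomputable def Psi (Φ : ℝ → ℝ → ℝ) (κ c t : ℝ) : ℝ := -spade Φ κ c (1 / t)

/-- The inverse of `Ψ` on its domain (meaningful on the image of `Ψ`). -/
noncomputable def PsiInv (Φ : ℝ → ℝ → ℝ) (κ c : ℝ) : ℝ → ℝ :=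
  Function.invFunOn (Psi Φ κ c) {t | 0 < t ∧ 1 / t ∈ dom Φ κ}

/-- `f`, restricted to some `[a,∞)` with `a > 0`, is regularly varying at infinity with
index `ρ`. -/
def IsRV (f : ℝ → ℝ) (ρ : ℝ) : Prop :=
  ∃ a, 0 < a ∧ (∀ x, a ≤ x → 0 < f x) ∧ Measurable ((Ici a).domRestrict f) ∧
    ∀ l : ℝ, 0 < l → Tendsto (fun x => f (l * x) / f x) atTop (𝓝 (l ^ ρ))

/-- `f`, restricted to some `(0,a]` with `a > 0`, is regularly varying at zero with index `ρ`. -/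
def IsRVZero (f : ℝ → ℝ) (ρ : ℝ) : Prop :=
  ∃ a, 0 < a ∧ (∀ x, 0 < x → x ≤ a → 0 < f x) ∧ Measurable ((Ioc 0 a).domRestrict f) ∧
    ∀ l : ℝ, 0 < l → Tendsto (fun x => f (l * x) / f x) (𝓝[>] 0) (𝓝 (l ^ ρ))

/-- `f`, restricted to some `[a,∞)` with `a > 0`, is rapidly varying (at infinity) of
index `+∞`. -/
def IsRapid (f : ℝ → ℝ) : Prop :=
  ∃ a, 0 < a ∧ (∀ x, a ≤ x → 0 < f x) ∧ Measurable ((Ici a).domRestrict f) ∧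
    (∀ l : ℝ, 0 < l → l < 1 → Tendsto (fun x => f (l * x) / f x) atTop (𝓝 0)) ∧
    Tendsto (fun x => f (1 * x) / f x) atTop (𝓝 1) ∧
    (∀ l : ℝ, 1 < l → Tendsto (fun x => f (l * x) / f x) atTop atTop)

end ErrorBound

/-!
Write `h = Φ(·, κ)`, `φ t = h (√t) ^ 2` and `g = φ⁻`, the inverse of `φ` on `(0, sup φ)`. Regular
and rapid variation are handled through the one-sided bounds `f (l x) ≤ M f x`, valid eventually
(`DilationBound`). Since a bound for `l⁻¹` gives the reverse bound for `l`, they recover the limits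
of `f (l x) / f x` (`HasIndexBounds.tendsto_div`, `HasRapidBounds.tendsto_div_zero`,
`HasRapidBounds.tendsto_div_atTop`), and they propagate through each construction.

* Inversion exchanges the dilation and the bound: a bound with `(N⁻¹, μ⁻¹)` for a function is a
  bound with `(μ, N)` for its inverse (`DilationBound.inverse`). The index `ρ` becomes `1 / ρ`, with
  index `0` and rapid variation interchanged. This is used for `φ ↦ g` and for `Ψ ↦ Ψ⁻¹`.
* The substitution `s = l⁻¹ v` in `Ψ t = ∫_{1/t}^c ds / g s` turns a bound `(l, M)` for `g` at `0`
  into a bound `(l, M')` for `Ψ` at `∞`, for every `M' > M / l` (`IsGauge.dilationBound_Psi`). It is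
  only necessary that `Ψ` tends to `∞`; the case `ρ = 1`, in which the index of `1 / g` is `-1`,
  is not special.

Hence `φ`, `g`, `Ψ`, `Ψ⁻¹` have the indices `ρ`, `1 / ρ`, `1 / ρ - 1`, `ρ / (1 - ρ)`, read with
`1 / 0 = ∞`. For a monotone function, iterating the bound for a single dilation gives power bounds
of Potter type (`DilationBound.exists_mul_rpow_le`, `DilationBound.exists_le_mul_rpow`). Applied to
`Ψ⁻¹ s = 1 / (Φ_κ^♠)⁻¹ (-s)` they yield the rates.

The geometry enters only through the inequality `t ≤ φ t` for small `t`
(`IsConsistent.eventually_le_phi`). Points `x` of the ball of radius `κ` satisfy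
`dist (x, C) ≤ h (dist (x, C))`, and `dist (·, C)` takes all small values on the segment from the
projection of `0` to `x₀`. The inequality gives `g s ≤ s` near `0`, so that the integral diverges at
`0` and `Ψ` tends to `∞` (`IsGauge.tendsto_spade`), and it excludes `ρ > 1`
(`IsGauge.index_le_one`).
-/

namespace ErrorBound

/-! ### Growth under dilation -/

/-- Along the filter `F`, dilating the argument by `l` multiplies `f` by at most `M`. -/
def DilationBound (F : Filter ℝ) (f : ℝ → ℝ) (l M : ℝ) : Prop :=
  ∀ᶠ x in F, f (l * x) ≤ M * f x

/-- The one-sided form of regular variation with index `ρ`. For positive `f` the bound for the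
dilation `l⁻¹` is a lower bound for the dilation `l`, so this captures the limit itself; see
`HasIndexBounds.tendsto_div`. -/
def HasIndexBounds (F : Filter ℝ) (f : ℝ → ℝ) (ρ : ℝ) : Prop :=
  ∀ l, 0 < l → ∀ M, l ^ ρ < M → DilationBound F f l M

/-- The one-sided form of rapid variation: `HasIndexBounds` with `ρ = +∞`, where only the
dilations `l < 1` carry information. -/
def HasRapidBounds (F : Filter ℝ) (f : ℝ → ℝ) : Prop :=
  ∀ l, 0 < l → l < 1 → ∀ M, 0 < M → DilationBound F f l M

/-- The filter is preserved by multiplication with positive constants. Both `atTop` and `𝓝[>] 0`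
are such filters. -/
def DilationInvariant (F : Filter ℝ) : Prop :=
  ∀ l : ℝ, 0 < l → Tendsto (fun x => l * x) F F

theorem dilationInvariant_atTop : DilationInvariant atTop :=
  fun _ hl => tendsto_id.const_mul_atTop hl

theorem dilationInvariant_nhdsGT_zero : DilationInvariant (𝓝[>] 0) := by
  intro l hl
  refine tendsto_nhdsWithin_iff.2 ⟨?_, ?_⟩
  · have h : Tendsto (fun x : ℝ => l * x) (𝓝 0) (𝓝 (l * 0)) := tendsto_id.const_mul l
    rw [mul_zero] at h
    exact h.mono_left nhdsWithin_le_nhds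
  · filter_upwards [self_mem_nhdsWithin] with x hx
    exact mul_pos hl hx

section Dilation

variable {F : Filter ℝ} {f : ℝ → ℝ} {l M ρ : ℝ}

/-- An upper bound for the dilation `l⁻¹` is a lower bound for the dilation `l`. -/
theorem DilationBound.le_apply_mul (hF : DilationInvariant F) (hl : 0 < l)
    (h : DilationBound F f l⁻¹ M⁻¹) (hM : 0 < M) : ∀ᶠ x in F, M * f x ≤ f (l * x) := by
  filter_upwards [(hF l hl).eventually h] with x hx
  rw [inv_mul_cancel_left₀ hl.ne'] at hx
  rwa [le_inv_mul_iff₀ hM] at hx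

theorem HasIndexBounds.tendsto_div (hF : DilationInvariant F) (hpos : ∀ᶠ x in F, 0 < f x)
    (h : HasIndexBounds F f ρ) (hl : 0 < l) :
    Tendsto (fun x => f (l * x) / f x) F (𝓝 (l ^ ρ)) := by
  refine tendsto_order.2 ⟨fun a ha => ?_, fun b hb => ?_⟩
  · obtain ⟨M, hM, hMl⟩ := exists_between (max_lt ha (Real.rpow_pos_of_pos hl ρ))
    have hM0 : 0 < M := (le_max_right _ _).trans_lt hM
    have hd : DilationBound F f l⁻¹ M⁻¹ := by
      refine h _ (inv_pos.2 hl) _ ?_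
      rw [Real.inv_rpow hl.le]
      exact inv_strictAnti₀ hM0 hMl
    filter_upwards [hd.le_apply_mul hF hl hM0, hpos] with x hx hx0
    rw [lt_div_iff₀ hx0]
    exact (mul_lt_mul_of_pos_right ((le_max_left _ _).trans_lt hM) hx0).trans_le hx
  · obtain ⟨M, hM, hMb⟩ := exists_between hb
    filter_upwards [h l hl M hM, hpos] with x hx hx0
    rw [div_lt_iff₀ hx0]
    exact hx.trans_lt (mul_lt_mul_of_pos_right hMb hx0)

theorem HasIndexBounds.of_tendsto (hpos : ∀ᶠ x in F, 0 < f x)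
    (h : ∀ l, 0 < l → Tendsto (fun x => f (l * x) / f x) F (𝓝 (l ^ ρ))) :
    HasIndexBounds F f ρ := by
  intro l hl M hM
  filter_upwards [(h l hl).eventually_lt_const hM, hpos] with x hx hx0
  exact ((div_lt_iff₀ hx0).1 hx).le

theorem HasRapidBounds.tendsto_div_zero (hF : DilationInvariant F) (hpos : ∀ᶠ x in F, 0 < f x)
    (h : HasRapidBounds F f) (hl : 0 < l) (hl1 : l < 1) :
    Tendsto (fun x => f (l * x) / f x) F (𝓝 0) := by
  refine tendsto_order.2 ⟨fun a ha => ?_, fun b hb => ?_⟩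
  · filter_upwards [hpos, (hF l hl).eventually hpos] with x hx hlx
    exact ha.trans (div_pos hlx hx)
  · filter_upwards [h l hl hl1 _ (half_pos hb), hpos] with x hx hx0
    rw [div_lt_iff₀ hx0]
    exact hx.trans_lt (mul_lt_mul_of_pos_right (half_lt_self hb) hx0)

theorem HasRapidBounds.tendsto_div_atTop (hF : DilationInvariant F) (hpos : ∀ᶠ x in F, 0 < f x)
    (h : HasRapidBounds F f) (hl1 : 1 < l) :
    Tendsto (fun x => f (l * x) / f x) F atTop := by
  have hl : 0 < l := one_pos.trans hl1
  refine tendsto_atTop.2 fun b => ?_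
  have hb : 0 < max b 1 := lt_max_of_lt_right one_pos
  have hd := (h l⁻¹ (inv_pos.2 hl) (inv_lt_one_of_one_lt₀ hl1) _ (inv_pos.2 hb)).le_apply_mul
    hF hl hb
  filter_upwards [hd, hpos] with x hx hx0
  rw [le_div_iff₀ hx0]
  exact (mul_le_mul_of_nonneg_right (le_max_left _ _) hx0.le).trans hx

/-- Passing to the inverse function `k` swaps the roles of the dilation and of the bound. The set
`D` is the domain on which `k` is the inverse of `f`. -/
theorem DilationBound.inverse {F' : Filter ℝ} {k : ℝ → ℝ} {D : Set ℝ} {μ N : ℝ}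
    (hF : DilationInvariant F) (hF' : DilationInvariant F') (hk : Tendsto k F' F)
    (hfk : ∀ᶠ s in F', f (k s) = s) (hD : D ∈ F)
    (hle : ∀ᶠ s in F', ∀ y ∈ D, f y ≤ s → y ≤ k s) (hμ : 0 < μ) (hN : 0 < N)
    (h : DilationBound F f N⁻¹ μ⁻¹) : DilationBound F' k μ N := by
  have hkμ : Tendsto (fun s => k (μ * s)) F' F := hk.comp (hF' μ hμ)
  filter_upwards [hkμ.eventually h, (hF' μ hμ).eventually hfk,
    ((hF _ (inv_pos.2 hN)).comp hkμ).eventually hD, hle] with s h1 h2 h3 h4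
  rw [h2, inv_mul_cancel_left₀ hμ.ne'] at h1
  exact (inv_mul_le_iff₀ hN).1 (h4 _ h3 h1)

section Inverse

variable {F' : Filter ℝ} {k : ℝ → ℝ} {D : Set ℝ}
  (hF : DilationInvariant F) (hF' : DilationInvariant F') (hk : Tendsto k F' F)
  (hfk : ∀ᶠ s in F', f (k s) = s) (hD : D ∈ F)
  (hle : ∀ᶠ s in F', ∀ y ∈ D, f y ≤ s → y ≤ k s)

include hF hF' hk hfk hD hle

theorem HasIndexBounds.inverse (hρ : 0 < ρ) (h : HasIndexBounds F f ρ) :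
    HasIndexBounds F' k (1 / ρ) := by
  intro μ hμ N hN
  have hN0 : 0 < N := (Real.rpow_pos_of_pos hμ _).trans hN
  refine DilationBound.inverse hF hF' hk hfk hD hle hμ hN0 (h _ (inv_pos.2 hN0) _ ?_)
  rw [Real.inv_rpow hN0.le]
  refine inv_strictAnti₀ hμ ?_
  have h1 := Real.rpow_lt_rpow (Real.rpow_nonneg hμ.le _) hN hρ
  rwa [← Real.rpow_mul hμ.le, one_div_mul_cancel hρ.ne', Real.rpow_one] at h1

theorem HasIndexBounds.inverse_of_zero (h : HasIndexBounds F f 0) : HasRapidBounds F' k := by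
  intro μ hμ hμ1 N hN
  refine DilationBound.inverse hF hF' hk hfk hD hle hμ hN (h _ (inv_pos.2 hN) _ ?_)
  rw [Real.rpow_zero]
  exact (one_lt_inv₀ hμ).2 hμ1

theorem HasRapidBounds.inverse (h : HasRapidBounds F f) : HasIndexBounds F' k 0 := by
  intro μ hμ N hN
  rw [Real.rpow_zero] at hN
  have hN0 : 0 < N := one_pos.trans hN
  exact DilationBound.inverse hF hF' hk hfk hD hle hμ hN0
    (h _ (inv_pos.2 hN0) (inv_lt_one_of_one_lt₀ hN) _ (inv_pos.2 hμ))

end Inverse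

end Dilation

section AtTop

variable {f : ℝ → ℝ} {ρ γ : ℝ}

theorem measurable_domRestrict_of_monotoneOn {s : Set ℝ} (h : MonotoneOn f s) :
    Measurable (s.domRestrict f) :=
  Monotone.measurable fun x y hxy => h x.2 y.2 hxy

theorem HasIndexBounds.isRV {a : ℝ} (ha : 0 < a) (hpos : ∀ x, a ≤ x → 0 < f x)
    (hmono : MonotoneOn f (Ici a)) (h : HasIndexBounds atTop f ρ) : IsRV f ρ :=
  ⟨a, ha, hpos, measurable_domRestrict_of_monotoneOn hmono, fun _ hl =>
    h.tendsto_div dilationInvariant_atTop ((eventually_ge_atTop a).mono hpos) hl⟩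

theorem HasRapidBounds.isRapid {a : ℝ} (ha : 0 < a) (hpos : ∀ x, a ≤ x → 0 < f x)
    (hmono : MonotoneOn f (Ici a)) (h : HasRapidBounds atTop f) : IsRapid f := by
  have hpos' : ∀ᶠ x in atTop, 0 < f x := (eventually_ge_atTop a).mono hpos
  refine ⟨a, ha, hpos, measurable_domRestrict_of_monotoneOn hmono, fun l hl hl1 =>
    h.tendsto_div_zero dilationInvariant_atTop hpos' hl hl1, ?_, fun l hl =>
    h.tendsto_div_atTop dilationInvariant_atTop hpos' hl⟩
  refine tendsto_const_nhds.congr' ?_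
  filter_upwards [hpos'] with x hx
  rw [one_mul, div_self hx.ne']

/-- Lower Potter-type bound: iterate the doubling estimate and interpolate by monotonicity. -/
theorem DilationBound.exists_mul_rpow_le (hpos : ∀ᶠ x in atTop, 0 < f x)
    (hmono : ∃ a, MonotoneOn f (Ici a)) (hγ : 0 ≤ γ)
    (h : DilationBound atTop f 2⁻¹ (2 ^ γ)⁻¹) :
    ∃ K, 0 < K ∧ ∀ᶠ x in atTop, K * x ^ γ ≤ f x := by
  obtain ⟨a₀, ha₀⟩ := hmono
  have h2 : (0 : ℝ) < 2 ^ γ := Real.rpow_pos_of_pos two_pos γ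
  obtain ⟨a₁, ha₁⟩ := eventually_atTop.1
    (hpos.and (h.le_apply_mul dilationInvariant_atTop two_pos h2))
  -- Beyond `a`, the function is positive and monotone and satisfies the doubling estimate.
  set a := max (max a₀ a₁) 1
  have ha0 : a₀ ≤ a := (le_max_left _ _).trans (le_max_left _ _)
  have ha1 : a₁ ≤ a := (le_max_right _ _).trans (le_max_left _ _)
  have ha : 0 < a := one_pos.trans_le (le_max_right _ _)
  have hle : ∀ n : ℕ, a ≤ 2 ^ n * a := fun n =>
    le_mul_of_one_le_left ha.le (one_le_pow₀ one_le_two)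
  have hiter : ∀ n : ℕ, ((2 : ℝ) ^ γ) ^ n * f a ≤ f (2 ^ n * a) := by
    intro n
    induction n with
    | zero => simp
    | succ n ih =>
      have h1 := (ha₁ _ (ha1.trans (hle n))).2
      rw [pow_succ' (2 : ℝ) n, mul_assoc 2, pow_succ', mul_assoc]
      exact (mul_le_mul_of_nonneg_left ih h2.le).trans h1
  have hfa : 0 < f a := (ha₁ a ha1).1
  refine ⟨f a / (2 * a) ^ γ, by positivity, ?_⟩
  filter_upwards [eventually_ge_atTop a] with x hx
  obtain ⟨n, hn, hn'⟩ := exists_nat_pow_near ((one_le_div ha).2 hx) (one_lt_two)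
  rw [le_div_iff₀ ha] at hn
  rw [div_lt_iff₀ ha] at hn'
  have hx0 : 0 ≤ x := ha.le.trans hx
  calc f a / (2 * a) ^ γ * x ^ γ = (x / (2 * a)) ^ γ * f a := by
        rw [Real.div_rpow hx0 (by positivity)]; ring
    _ ≤ ((2 : ℝ) ^ n) ^ γ * f a := by
        gcongr
        rw [div_le_iff₀ (by positivity)]
        calc x ≤ _ := hn'.le
          _ = _ := by ring
    _ = ((2 : ℝ) ^ γ) ^ n * f a := by rw [← Real.rpow_pow_comm two_pos.le]
    _ ≤ f (2 ^ n * a) := hiter n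
    _ ≤ f x := ha₀ (ha0.trans (hle n)) (ha0.trans hx) hn

/-- Upper Potter-type bound, obtained like `DilationBound.exists_mul_rpow_le`. -/
theorem DilationBound.exists_le_mul_rpow (hpos : ∀ᶠ x in atTop, 0 < f x)
    (hmono : ∃ a, MonotoneOn f (Ici a)) (hγ : 0 ≤ γ)
    (h : DilationBound atTop f 2 (2 ^ γ)) :
    ∃ K, 0 < K ∧ ∀ᶠ x in atTop, f x ≤ K * x ^ γ := by
  obtain ⟨a₀, ha₀⟩ := hmono
  have h2 : (0 : ℝ) < 2 ^ γ := Real.rpow_pos_of_pos two_pos γ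
  obtain ⟨a₁, ha₁⟩ := eventually_atTop.1 (hpos.and h)
  -- Beyond `a`, the function is positive and monotone and satisfies the doubling estimate.
  set a := max (max a₀ a₁) 1
  have ha0 : a₀ ≤ a := (le_max_left _ _).trans (le_max_left _ _)
  have ha1 : a₁ ≤ a := (le_max_right _ _).trans (le_max_left _ _)
  have ha : 0 < a := one_pos.trans_le (le_max_right _ _)
  have hle : ∀ n : ℕ, a ≤ 2 ^ n * a := fun n =>
    le_mul_of_one_le_left ha.le (one_le_pow₀ one_le_two)
  have hiter : ∀ n : ℕ, f (2 ^ n * a) ≤ ((2 : ℝ) ^ γ) ^ n * f a := by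
    intro n
    induction n with
    | zero => simp
    | succ n ih =>
      have h1 := (ha₁ _ (ha1.trans (hle n))).2
      rw [pow_succ' (2 : ℝ) n, mul_assoc 2, pow_succ', mul_assoc]
      exact h1.trans (mul_le_mul_of_nonneg_left ih h2.le)
  have hfa : 0 < f a := (ha₁ a ha1).1
  refine ⟨2 ^ γ * f a / a ^ γ, by positivity, ?_⟩
  filter_upwards [eventually_ge_atTop a] with x hx
  obtain ⟨n, hn, hn'⟩ := exists_nat_pow_near ((one_le_div ha).2 hx) (one_lt_two)
  rw [div_lt_iff₀ ha] at hn'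
  have hx0 : 0 ≤ x := ha.le.trans hx
  calc f x ≤ f (2 ^ (n + 1) * a) := ha₀ (ha0.trans hx) (ha0.trans (hle _)) hn'.le
    _ ≤ ((2 : ℝ) ^ γ) ^ (n + 1) * f a := hiter _
    _ = 2 ^ γ * f a * ((2 : ℝ) ^ n) ^ γ := by rw [← Real.rpow_pow_comm two_pos.le]; ring
    _ ≤ 2 ^ γ * f a * (x / a) ^ γ := by gcongr
    _ = 2 ^ γ * f a / a ^ γ * x ^ γ := by rw [Real.div_rpow hx0 ha.le]; ring

theorem isLittleO_rpow_rpow_atTop {p q : ℝ} (hpq : p < q) :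
    (fun x : ℝ => x ^ p) =o[atTop] (fun x : ℝ => x ^ q) := by
  refine (isLittleO_iff_tendsto' ?_).2 ?_
  · filter_upwards [eventually_gt_atTop 0] with x hx h0
    exact absurd h0 (Real.rpow_pos_of_pos hx q).ne'
  · refine (tendsto_rpow_neg_atTop (sub_pos.2 hpq)).congr' ?_
    filter_upwards [eventually_gt_atTop 0] with x hx
    rw [neg_sub, Real.rpow_sub hx]

theorem HasIndexBounds.dilationBound_half {F : Filter ℝ} (h : HasIndexBounds F f ρ) (hγ : γ < ρ) :
    DilationBound F f 2⁻¹ (2 ^ γ)⁻¹ := by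
  refine h _ (by norm_num) _ ?_
  rw [Real.inv_rpow two_pos.le]
  exact inv_strictAnti₀ (by positivity) (Real.rpow_lt_rpow_of_exponent_lt one_lt_two hγ)

end AtTop

/-! ### The function `φ` and its inverse -/

/-- The properties of a strict consistent error bound function with continuous `κ`-section that
concern this section alone. -/
structure IsGauge (Φ : ℝ → ℝ → ℝ) (κ : ℝ) : Prop where
  strictMono : StrictMonoOn (fun a => Φ a κ) (Ici 0)
  continuous : ContinuousOn (fun a => Φ a κ) (Ici 0)
  map_zero : Φ 0 κ = 0

variable {Φ : ℝ → ℝ → ℝ} {κ c : ℝ}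

namespace IsGauge

theorem nonneg (h : IsGauge Φ κ) {a : ℝ} (ha : 0 ≤ a) : 0 ≤ Φ a κ :=
  h.map_zero ▸ h.strictMono.monotoneOn self_mem_Ici ha ha

theorem pos (h : IsGauge Φ κ) {a : ℝ} (ha : 0 < a) : 0 < Φ a κ :=
  h.map_zero ▸ h.strictMono self_mem_Ici ha.le ha

theorem phi_zero (h : IsGauge Φ κ) : phi Φ κ 0 = 0 := by simp [phi, h.map_zero]

theorem phi_strictMonoOn (h : IsGauge Φ κ) : StrictMonoOn (phi Φ κ) (Ici 0) :=
  fun _ hx _ _ hxy => pow_lt_pow_left₀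
    (h.strictMono (Real.sqrt_nonneg _) (Real.sqrt_nonneg _) (Real.sqrt_lt_sqrt hx hxy))
    (h.nonneg (Real.sqrt_nonneg _)) two_ne_zero

theorem phi_pos (h : IsGauge Φ κ) {t : ℝ} (ht : 0 < t) : 0 < phi Φ κ t :=
  pow_pos (h.pos (Real.sqrt_pos.2 ht)) 2

theorem phi_continuousOn (h : IsGauge Φ κ) : ContinuousOn (phi Φ κ) (Ici 0) :=
  (h.continuous.comp Real.continuous_sqrt.continuousOn fun _ _ => Real.sqrt_nonneg _).pow 2

theorem phi_mem_dom (h : IsGauge Φ κ) {u : ℝ} (hu : 0 < u) : phi Φ κ u ∈ dom Φ κ :=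
  ⟨h.phi_pos hu, u + 1, by positivity,
    h.phi_strictMonoOn hu.le (add_pos hu one_pos).le (lt_add_one u)⟩

theorem exists_phi_eq (h : IsGauge Φ κ) {s : ℝ} (hs : s ∈ dom Φ κ) :
    ∃ u, 0 < u ∧ phi Φ κ u = s := by
  obtain ⟨hs0, v, hv, hsv⟩ := hs
  obtain ⟨u, hu, rfl⟩ := intermediate_value_Icc hv (h.phi_continuousOn.mono Icc_subset_Ici_self)
    ⟨h.phi_zero.symm ▸ hs0.le, hsv.le⟩
  refine ⟨u, hu.1.lt_of_ne ?_, rfl⟩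
  rintro rfl
  exact hs0.ne' h.phi_zero

theorem genInv_phi (h : IsGauge Φ κ) {u : ℝ} (hu : 0 ≤ u) :
    genInv (phi Φ κ) (phi Φ κ u) = u := by
  have : {t | 0 ≤ t ∧ phi Φ κ u ≤ phi Φ κ t} = Ici u := by
    ext t
    refine ⟨fun ht => (h.phi_strictMonoOn.le_iff_le hu ht.1).1 ht.2, fun ht => ?_⟩
    exact ⟨hu.trans ht, h.phi_strictMonoOn.monotoneOn hu (hu.trans ht) ht⟩
  rw [genInv, this, csInf_Ici]

theorem genInv_pos (h : IsGauge Φ κ) {s : ℝ} (hs : s ∈ dom Φ κ) : 0 < genInv (phi Φ κ) s := by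
  obtain ⟨u, hu, rfl⟩ := h.exists_phi_eq hs
  rwa [h.genInv_phi hu.le]

theorem phi_genInv (h : IsGauge Φ κ) {s : ℝ} (hs : s ∈ dom Φ κ) :
    phi Φ κ (genInv (phi Φ κ) s) = s := by
  obtain ⟨u, hu, rfl⟩ := h.exists_phi_eq hs
  rw [h.genInv_phi hu.le]

theorem le_genInv (h : IsGauge Φ κ) {s y : ℝ} (hs : s ∈ dom Φ κ) (hy : 0 ≤ y)
    (hys : phi Φ κ y ≤ s) : y ≤ genInv (phi Φ κ) s := by
  rw [← h.phi_genInv hs] at hys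
  exact (h.phi_strictMonoOn.le_iff_le hy (h.genInv_pos hs).le).1 hys

theorem genInv_le (h : IsGauge Φ κ) {s y : ℝ} (hs : s ∈ dom Φ κ) (hy : 0 ≤ y)
    (hys : s ≤ phi Φ κ y) : genInv (phi Φ κ) s ≤ y := by
  rw [← h.phi_genInv hs] at hys
  exact (h.phi_strictMonoOn.le_iff_le (h.genInv_pos hs).le hy).1 hys

theorem genInv_monotoneOn (h : IsGauge Φ κ) : MonotoneOn (genInv (phi Φ κ)) (dom Φ κ) :=
  fun _ hs _ ht hst => h.le_genInv ht (h.genInv_pos hs).le ((h.phi_genInv hs).trans_le hst)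

end IsGauge

theorem mem_dom_of_le {s t : ℝ} (ht : t ∈ dom Φ κ) (hs : 0 < s) (hst : s ≤ t) : s ∈ dom Φ κ :=
  ⟨hs, ht.2.imp fun _ hu => ⟨hu.1, hst.trans_lt hu.2⟩⟩

theorem uIcc_subset_dom {s t : ℝ} (hs : s ∈ dom Φ κ) (ht : t ∈ dom Φ κ) :
    uIcc s t ⊆ dom Φ κ := fun x hx =>
  mem_dom_of_le (by rcases max_choice s t with h | h <;> rwa [h]) ((lt_min hs.1 ht.1).trans_le hx.1)
    hx.2

namespace IsGauge

theorem dom_mem_nhdsGT_zero (h : IsGauge Φ κ) : dom Φ κ ∈ 𝓝[>] (0 : ℝ) := by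
  filter_upwards [Ioc_mem_nhdsGT (h.phi_pos one_pos)] with t ht
  exact mem_dom_of_le (h.phi_mem_dom one_pos) ht.1 ht.2

theorem tendsto_genInv (h : IsGauge Φ κ) : Tendsto (genInv (phi Φ κ)) (𝓝[>] 0) (𝓝[>] 0) := by
  have hpos : ∀ᶠ s in 𝓝[>] (0 : ℝ), 0 < genInv (phi Φ κ) s := by
    filter_upwards [h.dom_mem_nhdsGT_zero] with s hs using h.genInv_pos hs
  refine tendsto_nhdsWithin_iff.2 ⟨tendsto_order.2 ⟨fun a ha => hpos.mono fun s => ha.trans,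
    fun b hb => ?_⟩, hpos⟩
  filter_upwards [h.dom_mem_nhdsGT_zero, Ioc_mem_nhdsGT (h.phi_pos (half_pos hb))] with s hs hsb
  exact (h.genInv_le hs (half_pos hb).le hsb.2).trans_lt (half_lt_self hb)

theorem phi_hasIndexBounds (h : IsGauge Φ κ) {ρ : ℝ} (hρ : IsRVZero (fun a => Φ a κ) ρ) :
    HasIndexBounds (𝓝[>] 0) (phi Φ κ) ρ := by
  refine HasIndexBounds.of_tendsto ?_ fun l hl => ?_
  · filter_upwards [self_mem_nhdsWithin] with t ht using h.phi_pos ht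
  · obtain ⟨-, -, -, -, hlim⟩ := hρ
    have hs : Tendsto Real.sqrt (𝓝[>] 0) (𝓝[>] 0) := by
      refine tendsto_nhdsWithin_iff.2 ⟨?_, ?_⟩
      · simpa using (Real.continuous_sqrt.tendsto 0).mono_left nhdsWithin_le_nhds
      · filter_upwards [self_mem_nhdsWithin] with t ht using Real.sqrt_pos.2 ht
    have h1 := ((hlim _ (Real.sqrt_pos.2 hl)).comp hs).pow 2
    have h2 : (√l ^ ρ) ^ 2 = l ^ ρ := by
      rw [Real.rpow_pow_comm (Real.sqrt_nonneg l), Real.sq_sqrt hl.le]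
    rw [h2] at h1
    refine h1.congr fun t => ?_
    simp only [Function.comp_apply, phi, Real.sqrt_mul hl.le, div_pow]

section GenInvBounds

variable {ρ : ℝ}

theorem eventually_phi_genInv (h : IsGauge Φ κ) :
    ∀ᶠ s in 𝓝[>] (0 : ℝ), phi Φ κ (genInv (phi Φ κ) s) = s := by
  filter_upwards [h.dom_mem_nhdsGT_zero] with s hs using h.phi_genInv hs

theorem eventually_le_genInv (h : IsGauge Φ κ) :
    ∀ᶠ s in 𝓝[>] (0 : ℝ), ∀ y ∈ Ioi (0 : ℝ), phi Φ κ y ≤ s → y ≤ genInv (phi Φ κ) s := by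
  filter_upwards [h.dom_mem_nhdsGT_zero] with s hs y hy using h.le_genInv hs (le_of_lt hy)

theorem genInv_hasIndexBounds (h : IsGauge Φ κ) (hρ : 0 < ρ)
    (hb : HasIndexBounds (𝓝[>] 0) (phi Φ κ) ρ) :
    HasIndexBounds (𝓝[>] 0) (genInv (phi Φ κ)) (1 / ρ) :=
  hb.inverse dilationInvariant_nhdsGT_zero dilationInvariant_nhdsGT_zero h.tendsto_genInv
    h.eventually_phi_genInv self_mem_nhdsWithin h.eventually_le_genInv hρ

theorem genInv_hasRapidBounds (h : IsGauge Φ κ) (hb : HasIndexBounds (𝓝[>] 0) (phi Φ κ) 0) :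
    HasRapidBounds (𝓝[>] 0) (genInv (phi Φ κ)) :=
  hb.inverse_of_zero dilationInvariant_nhdsGT_zero dilationInvariant_nhdsGT_zero h.tendsto_genInv
    h.eventually_phi_genInv self_mem_nhdsWithin h.eventually_le_genInv

end GenInvBounds

/-! ### The inverse smoothing function -/

theorem antitoneOn_one_div_genInv (h : IsGauge Φ κ) :
    AntitoneOn (fun s => 1 / genInv (phi Φ κ) s) (dom Φ κ) := fun _ hs _ ht hst =>
  one_div_le_one_div_of_le (h.genInv_pos hs) (h.genInv_monotoneOn hs ht hst)

theorem intervalIntegrable (h : IsGauge Φ κ) {s t : ℝ} (hs : s ∈ dom Φ κ) (ht : t ∈ dom Φ κ) :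
    IntervalIntegrable (fun s => 1 / genInv (phi Φ κ) s) MeasureTheory.volume s t :=
  (h.antitoneOn_one_div_genInv.mono (uIcc_subset_dom hs ht)).intervalIntegrable

theorem spade_sub_spade (h : IsGauge Φ κ) (hc : c ∈ dom Φ κ) {s t : ℝ} (hs : s ∈ dom Φ κ)
    (ht : t ∈ dom Φ κ) :
    spade Φ κ c t - spade Φ κ c s = ∫ x in s..t, 1 / genInv (phi Φ κ) x :=
  intervalIntegral.integral_interval_sub_left (h.intervalIntegrable hc ht)
    (h.intervalIntegrable hc hs)

theorem spade_strictMonoOn (h : IsGauge Φ κ) (hc : c ∈ dom Φ κ) :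
    StrictMonoOn (spade Φ κ c) (dom Φ κ) := fun s hs t ht hst => by
  rw [← sub_pos, h.spade_sub_spade hc hs ht]
  refine intervalIntegral.intervalIntegral_pos_of_pos_on (h.intervalIntegrable hs ht)
    (fun x hx => ?_) hst
  exact one_div_pos.2 (h.genInv_pos (mem_dom_of_le ht (hs.1.trans hx.1) hx.2.le))

/-- If `t ≤ φ t` near `0`, then `φ⁻ s ≤ s` near `0`, and the integral diverges at `0` at least as
fast as the logarithm. -/
theorem tendsto_spade (h : IsGauge Φ κ) (hc : c ∈ dom Φ κ)
    (hle : ∀ᶠ t in 𝓝[>] (0 : ℝ), t ≤ phi Φ κ t) : Tendsto (spade Φ κ c) (𝓝[>] 0) atBot := by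
  obtain ⟨b₀, hb₀, hb⟩ := (nhdsGT_basis (0 : ℝ)).eventually_iff.1
    (hle.and h.dom_mem_nhdsGT_zero)
  obtain ⟨b, hb1, hb2⟩ := exists_between hb₀
  have hbd : b ∈ dom Φ κ := (hb ⟨hb1, hb2⟩).2
  have hlim : Tendsto (fun t => spade Φ κ c b - Real.log b + Real.log t) (𝓝[>] 0) atBot :=
    tendsto_atBot_add_const_left _ _ Real.tendsto_log_nhdsGT_zero
  refine tendsto_atBot_mono' _ ?_ hlim
  filter_upwards [Ioc_mem_nhdsGT hb1] with t ht
  have htd : t ∈ dom Φ κ := mem_dom_of_le hbd ht.1 ht.2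
  have key : (∫ x in t..b, 1 / x) ≤ ∫ x in t..b, 1 / genInv (phi Φ κ) x := by
    refine intervalIntegral.integral_mono_on ht.2 ?_ (h.intervalIntegrable htd hbd) fun x hx => ?_
    · refine intervalIntegral.intervalIntegrable_one_div (fun x hx => ?_) continuousOn_id
      rw [uIcc_of_le ht.2] at hx
      exact (ht.1.trans_le hx.1).ne'
    · have hx0 : 0 < x := ht.1.trans_le hx.1
      have hxd : x ∈ dom Φ κ := mem_dom_of_le hbd hx0 hx.2
      exact one_div_le_one_div_of_le (h.genInv_pos hxd)
        (h.genInv_le hxd hx0.le (hb ⟨hx0, hx.2.trans_lt hb2⟩).1)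
  rw [← h.spade_sub_spade hc htd hbd, integral_one_div_of_pos ht.1 hb1,
    Real.log_div hb1.ne' ht.1.ne'] at key
  linarith

theorem neg_mem_image_spade (h : IsGauge Φ κ) (hc : c ∈ dom Φ κ)
    (hlim : Tendsto (spade Φ κ c) (𝓝[>] 0) atBot) {s : ℝ} (hs : 0 ≤ s) :
    -s ∈ spade Φ κ c '' dom Φ κ := by
  obtain ⟨t, htc, hts⟩ := ((Filter.eventually_mem_set.2 (Ioc_mem_nhdsGT hc.1)).and
    (hlim.eventually_le_atBot (-s))).exists
  have htd : t ∈ dom Φ κ := mem_dom_of_le hc htc.1 htc.2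
  have hcont : ContinuousOn (spade Φ κ c) (Icc t c) := by
    rw [← uIcc_of_le htc.2]
    exact intervalIntegral.continuousOn_primitive_interval' (h.intervalIntegrable htd hc)
      right_mem_uIcc
  have hcc : spade Φ κ c c = 0 := intervalIntegral.integral_same
  obtain ⟨x, hx, hxs⟩ := intermediate_value_Icc htc.2 hcont ⟨hts, hcc.symm ▸ neg_nonpos.2 hs⟩
  exact ⟨x, mem_dom_of_le hc (htc.1.trans_le hx.1) hx.2, hxs⟩

/-! ### Growth of `Ψ` -/

/-- Substituting `s = l⁻¹ v` in the integral turns a dilation bound for `φ⁻` into one for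
`-Φ_κ^♠`, up to an additive constant; the latter is absorbed because `-Φ_κ^♠` diverges. -/
theorem dilationBound_Psi (h : IsGauge Φ κ) (hc : c ∈ dom Φ κ)
    (hlim : Tendsto (spade Φ κ c) (𝓝[>] 0) atBot) {l M M' : ℝ} (hl : 0 < l) (hM : M / l < M')
    (hb : DilationBound (𝓝[>] 0) (genInv (phi Φ κ)) l M) :
    DilationBound atTop (Psi Φ κ c) l M' := by
  have hl' : 0 < l⁻¹ := inv_pos.2 hl
  have hinv := dilationInvariant_nhdsGT_zero _ hl'
  obtain ⟨v₀, hv₀, hv⟩ := (nhdsGT_basis (0 : ℝ)).eventually_iff.1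
    (((hinv.eventually hb).and h.dom_mem_nhdsGT_zero).and (hinv.eventually h.dom_mem_nhdsGT_zero))
  obtain ⟨v, hv0, hvv⟩ := exists_between hv₀
  have hvd := (hv ⟨hv0, hvv⟩).1.2
  have hvd' := (hv ⟨hv0, hvv⟩).2
  -- The slack `M' - M / l > 0` pays for the part of the integral between `v` and `c`.
  have hlim' : Tendsto (fun τ => (M' - M / l) * -spade Φ κ c τ) (𝓝[>] 0) atTop :=
    (tendsto_neg_atBot_atTop.comp hlim).const_mul_atTop (sub_pos.2 hM)
  have key : ∀ᶠ τ in 𝓝[>] (0 : ℝ), -spade Φ κ c (l⁻¹ * τ) ≤ M' * -spade Φ κ c τ := by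
    filter_upwards [Ioc_mem_nhdsGT hv0,
      hlim'.eventually_ge_atTop (M / l * spade Φ κ c v - spade Φ κ c (l⁻¹ * v))] with τ hτ hK
    have hτd : τ ∈ dom Φ κ := mem_dom_of_le hvd hτ.1 hτ.2
    have hτd' : l⁻¹ * τ ∈ dom Φ κ :=
      mem_dom_of_le hvd' (mul_pos hl' hτ.1) (mul_le_mul_of_nonneg_left hτ.2 hl'.le)
    have hmem : ∀ x ∈ Icc τ v, x ∈ Ioo 0 v₀ := fun x hx =>
      ⟨hτ.1.trans_le hx.1, hx.2.trans_lt hvv⟩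
    have hint : IntervalIntegrable (fun x => 1 / genInv (phi Φ κ) (l⁻¹ * x))
        MeasureTheory.volume τ v := by
      refine AntitoneOn.intervalIntegrable fun x hx y hy hxy => ?_
      rw [uIcc_of_le hτ.2] at hx hy
      exact h.antitoneOn_one_div_genInv (hv (hmem x hx)).2 (hv (hmem y hy)).2
        (mul_le_mul_of_nonneg_left hxy hl'.le)
    have hmono : (∫ x in τ..v, 1 / genInv (phi Φ κ) (l⁻¹ * x)) ≤
        ∫ x in τ..v, M * (1 / genInv (phi Φ κ) x) := by
      refine intervalIntegral.integral_mono_on hτ.2 hint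
        ((h.intervalIntegrable hτd hvd).const_mul M) fun x hx => ?_
      obtain ⟨⟨h1, h2⟩, h3⟩ := hv (hmem x hx)
      rw [mul_inv_cancel_left₀ hl.ne'] at h1
      rw [mul_one_div, div_le_div_iff₀ (h.genInv_pos h3) (h.genInv_pos h2), one_mul]
      exact h1
    have hsub := mul_le_mul_of_nonneg_left hmono hl'.le
    rw [intervalIntegral.mul_integral_comp_mul_left (f := fun x => 1 / genInv (phi Φ κ) x),
      intervalIntegral.integral_const_mul, ← h.spade_sub_spade hc hτd hvd,
      ← h.spade_sub_spade hc hτd' hvd', ← mul_assoc,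
      show l⁻¹ * M = M / l from inv_mul_eq_div _ _] at hsub
    linarith
  have htop : Tendsto (fun t : ℝ => 1 / t) atTop (𝓝[>] 0) := by
    simpa only [one_div] using tendsto_inv_atTop_nhdsGT_zero
  filter_upwards [htop.eventually key] with t ht
  rwa [Psi, Psi, ← one_div_mul_one_div, one_div l]

end IsGauge

/-! ### The inverse of `Ψ` and the convergence rates -/

/-- The domain of `Ψ`, that is, `(1 / sup φ, ∞)`. -/
def psiDom (Φ : ℝ → ℝ → ℝ) (κ : ℝ) : Set ℝ := {t | 0 < t ∧ 1 / t ∈ dom Φ κ}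

theorem mem_psiDom_of_le {s t : ℝ} (hs : s ∈ psiDom Φ κ) (hst : s ≤ t) : t ∈ psiDom Φ κ :=
  have ht : 0 < t := hs.1.trans_le hst
  ⟨ht, mem_dom_of_le hs.2 (one_div_pos.2 ht) (one_div_le_one_div_of_le hs.1 hst)⟩

theorem one_div_mem_psiDom {t : ℝ} (ht : t ∈ dom Φ κ) : 1 / t ∈ psiDom Φ κ :=
  ⟨one_div_pos.2 ht.1, by rwa [one_div_one_div]⟩

theorem psiDom_mem_atTop (hc : c ∈ dom Φ κ) : psiDom Φ κ ∈ atTop := by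
  filter_upwards [eventually_ge_atTop (1 / c)] with t ht
  exact mem_psiDom_of_le (one_div_mem_psiDom hc) ht

namespace IsGauge

theorem Psi_strictMonoOn (h : IsGauge Φ κ) (hc : c ∈ dom Φ κ) :
    StrictMonoOn (Psi Φ κ c) (psiDom Φ κ) := fun _ hs _ ht hst =>
  neg_lt_neg (h.spade_strictMonoOn hc ht.2 hs.2 (one_div_lt_one_div_of_lt hs.1 hst))

theorem Psi_pos (h : IsGauge Φ κ) (hc : c ∈ dom Φ κ) {t : ℝ} (ht : 1 / c < t) :
    0 < Psi Φ κ c t := by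
  have h0 : Psi Φ κ c (1 / c) = 0 := by simp [Psi, spade]
  have hcd := one_div_mem_psiDom hc
  exact h0 ▸ h.Psi_strictMonoOn hc hcd (mem_psiDom_of_le hcd ht.le) ht

theorem Psi_hasIndexBounds (h : IsGauge Φ κ) (hc : c ∈ dom Φ κ)
    (hlim : Tendsto (spade Φ κ c) (𝓝[>] 0) atBot) {σ : ℝ}
    (hb : HasIndexBounds (𝓝[>] 0) (genInv (phi Φ κ)) σ) :
    HasIndexBounds atTop (Psi Φ κ c) (σ - 1) := by
  intro l hl M hM
  rw [Real.rpow_sub_one hl.ne', div_lt_iff₀ hl] at hM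
  obtain ⟨M₀, hM₀, hM₀'⟩ := exists_between hM
  exact h.dilationBound_Psi hc hlim hl ((div_lt_iff₀ hl).2 hM₀') (hb l hl M₀ hM₀)

theorem Psi_hasRapidBounds (h : IsGauge Φ κ) (hc : c ∈ dom Φ κ)
    (hlim : Tendsto (spade Φ κ c) (𝓝[>] 0) atBot)
    (hb : HasRapidBounds (𝓝[>] 0) (genInv (phi Φ κ))) :
    HasRapidBounds atTop (Psi Φ κ c) := by
  intro l hl hl1 M hM
  have hMl : 0 < M * l := mul_pos hM hl
  exact h.dilationBound_Psi hc hlim hl ((div_lt_iff₀ hl).2 (half_lt_self hMl))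
    (hb l hl hl1 _ (half_pos hMl))

section PsiInv

variable (h : IsGauge Φ κ) (hc : c ∈ dom Φ κ)
  (hlim : Tendsto (spade Φ κ c) (𝓝[>] 0) atBot) {s y ρ : ℝ}

include h hc hlim

theorem exists_Psi_eq (hs : 0 ≤ s) : ∃ t ∈ psiDom Φ κ, Psi Φ κ c t = s := by
  obtain ⟨t, ht, hts⟩ := h.neg_mem_image_spade hc hlim hs
  exact ⟨1 / t, one_div_mem_psiDom ht, by rw [Psi, one_div_one_div, hts, neg_neg]⟩

theorem PsiInv_mem (hs : 0 ≤ s) : PsiInv Φ κ c s ∈ psiDom Φ κ :=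
  Function.invFunOn_mem (h.exists_Psi_eq hc hlim hs)

theorem Psi_PsiInv (hs : 0 ≤ s) : Psi Φ κ c (PsiInv Φ κ c s) = s :=
  Function.invFunOn_eq (h.exists_Psi_eq hc hlim hs)

theorem le_PsiInv (hs : 0 ≤ s) (hy : y ∈ psiDom Φ κ) (hys : Psi Φ κ c y ≤ s) :
    y ≤ PsiInv Φ κ c s := by
  rw [← h.Psi_PsiInv hc hlim hs] at hys
  exact ((h.Psi_strictMonoOn hc).le_iff_le hy (h.PsiInv_mem hc hlim hs)).1 hys

theorem PsiInv_monotoneOn : MonotoneOn (PsiInv Φ κ c) (Ici 0) := fun _ hs _ ht hst =>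
  h.le_PsiInv hc hlim ht (h.PsiInv_mem hc hlim hs) ((h.Psi_PsiInv hc hlim hs).trans_le hst)

theorem tendsto_PsiInv : Tendsto (PsiInv Φ κ c) atTop atTop := by
  refine tendsto_atTop.2 fun b => ?_
  have hd : max b (1 / c) ∈ psiDom Φ κ :=
    mem_psiDom_of_le (one_div_mem_psiDom hc) (le_max_right _ _)
  filter_upwards [eventually_ge_atTop 0, eventually_ge_atTop (Psi Φ κ c (max b (1 / c)))]
    with s hs hs'
  exact (le_max_left _ _).trans (h.le_PsiInv hc hlim hs hd hs')

theorem spadeInv_neg (hs : 0 ≤ s) : spadeInv Φ κ c (-s) = 1 / PsiInv Φ κ c s := by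
  have hmem := h.neg_mem_image_spade hc hlim hs
  refine (h.spade_strictMonoOn hc).injOn (Function.invFunOn_mem hmem)
    (h.PsiInv_mem hc hlim hs).2 ?_
  have h1 := h.Psi_PsiInv hc hlim hs
  rw [Psi, neg_eq_iff_eq_neg] at h1
  exact (Function.invFunOn_eq hmem).trans h1.symm

theorem eventually_Psi_PsiInv : ∀ᶠ s in atTop, Psi Φ κ c (PsiInv Φ κ c s) = s :=
  (eventually_ge_atTop 0).mono fun _ => h.Psi_PsiInv hc hlim

theorem eventually_le_PsiInv :
    ∀ᶠ s in atTop, ∀ y ∈ psiDom Φ κ, Psi Φ κ c y ≤ s → y ≤ PsiInv Φ κ c s :=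
  (eventually_ge_atTop 0).mono fun _ hs _ => h.le_PsiInv hc hlim hs

theorem PsiInv_hasIndexBounds (hρ : 0 < ρ) (hb : HasIndexBounds atTop (Psi Φ κ c) ρ) :
    HasIndexBounds atTop (PsiInv Φ κ c) (1 / ρ) :=
  hb.inverse dilationInvariant_atTop dilationInvariant_atTop (h.tendsto_PsiInv hc hlim)
    (h.eventually_Psi_PsiInv hc hlim) (psiDom_mem_atTop hc) (h.eventually_le_PsiInv hc hlim) hρ

theorem PsiInv_hasRapidBounds (hb : HasIndexBounds atTop (Psi Φ κ c) 0) :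
    HasRapidBounds atTop (PsiInv Φ κ c) :=
  hb.inverse_of_zero dilationInvariant_atTop dilationInvariant_atTop (h.tendsto_PsiInv hc hlim)
    (h.eventually_Psi_PsiInv hc hlim) (psiDom_mem_atTop hc) (h.eventually_le_PsiInv hc hlim)

theorem PsiInv_hasIndexBounds_zero (hb : HasRapidBounds atTop (Psi Φ κ c)) :
    HasIndexBounds atTop (PsiInv Φ κ c) 0 :=
  hb.inverse dilationInvariant_atTop dilationInvariant_atTop (h.tendsto_PsiInv hc hlim)
    (h.eventually_Psi_PsiInv hc hlim) (psiDom_mem_atTop hc) (h.eventually_le_PsiInv hc hlim)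

theorem isRV_PsiInv (hb : HasIndexBounds atTop (PsiInv Φ κ c) ρ) : IsRV (PsiInv Φ κ c) ρ :=
  hb.isRV one_pos (fun _ hs => (h.PsiInv_mem hc hlim (zero_le_one.trans hs)).1)
    ((h.PsiInv_monotoneOn hc hlim).mono (Ici_subset_Ici.2 zero_le_one))

theorem isRapid_PsiInv (hb : HasRapidBounds atTop (PsiInv Φ κ c)) : IsRapid (PsiInv Φ κ c) :=
  hb.isRapid one_pos (fun _ hs => (h.PsiInv_mem hc hlim (zero_le_one.trans hs)).1)
    ((h.PsiInv_monotoneOn hc hlim).mono (Ici_subset_Ici.2 zero_le_one))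

theorem eventually_PsiInv_pos : ∀ᶠ s in atTop, 0 < PsiInv Φ κ c s :=
  (h.tendsto_PsiInv hc hlim).eventually_gt_atTop 0

/-- The lower Potter bound for `Ψ⁻¹`, transferred to `(Φ_κ^♠)⁻¹ (-s) = 1 / Ψ⁻¹ s`. -/
theorem exists_sqrt_spadeInv_le {γ : ℝ} (hγ : 0 ≤ γ)
    (hb : DilationBound atTop (PsiInv Φ κ c) 2⁻¹ (2 ^ γ)⁻¹) :
    ∃ M A : ℝ, 0 < M ∧ 0 < A ∧ ∀ s, M ≤ s →
      Real.sqrt (spadeInv Φ κ c (-s)) ≤ A * (1 / s) ^ (γ / 2) := by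
  obtain ⟨K, hK, hKs⟩ := hb.exists_mul_rpow_le (h.eventually_PsiInv_pos hc hlim)
    ⟨0, h.PsiInv_monotoneOn hc hlim⟩ hγ
  obtain ⟨M, hM⟩ := eventually_atTop.1 hKs
  refine ⟨max M 1, √(1 / K), lt_max_of_lt_right one_pos, by positivity, fun s hs => ?_⟩
  have hs0 : 0 < s := one_pos.trans_le ((le_max_right _ _).trans hs)
  rw [h.spadeInv_neg hc hlim hs0.le]
  have h1 : (1 / s) ^ (γ / 2) = √((1 / s) ^ γ) := by
    rw [Real.sqrt_eq_rpow, ← Real.rpow_mul (by positivity), mul_one_div]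
  rw [h1, ← Real.sqrt_mul (by positivity)]
  refine Real.sqrt_le_sqrt ?_
  rw [Real.div_rpow zero_le_one hs0.le, Real.one_rpow, one_div_mul_one_div]
  exact one_div_le_one_div_of_le (by positivity) (hM s ((le_max_left _ _).trans hs))

theorem sqrt_spadeInv_isLittleO (hb : HasRapidBounds atTop (PsiInv Φ κ c)) {r : ℝ} (hr : 0 < r) :
    (fun s : ℝ => Real.sqrt (spadeInv Φ κ c (-s))) =o[atTop] (fun s : ℝ => s ^ (-r)) := by
  -- Any exponent above `2 * r` works, as rapid variation exceeds every power.
  obtain ⟨M, A, hM, hA, hMA⟩ := h.exists_sqrt_spadeInv_le hc hlim (γ := 2 * (r + 1))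
    (by positivity) (hb _ (by norm_num) (by norm_num) _ (by positivity))
  have h1 : (fun s : ℝ => Real.sqrt (spadeInv Φ κ c (-s))) =O[atTop]
      (fun s : ℝ => s ^ (-(r + 1))) := by
    refine IsBigO.of_bound A ?_
    filter_upwards [eventually_ge_atTop M] with s hs
    have hs0 : 0 < s := hM.trans_le hs
    rw [Real.norm_of_nonneg (Real.sqrt_nonneg _), Real.norm_of_nonneg (by positivity),
      Real.rpow_neg hs0.le, ← Real.inv_rpow hs0.le, ← one_div]
    have := hMA s hs
    rwa [mul_div_cancel_left₀ _ two_ne_zero] at this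
  exact h1.trans_isLittleO (isLittleO_rpow_rpow_atTop (by linarith))

theorem rpow_neg_isLittleO_spadeInv (hb : HasIndexBounds atTop (PsiInv Φ κ c) 0) {r : ℝ}
    (hr : 0 < r) : (fun s : ℝ => s ^ (-r)) =o[atTop] (fun s : ℝ => spadeInv Φ κ c (-s)) := by
  have hb2 : DilationBound atTop (PsiInv Φ κ c) 2 (2 ^ (r / 2)) :=
    hb 2 two_pos _ (by rw [Real.rpow_zero]; exact Real.one_lt_rpow one_lt_two (half_pos hr))
  obtain ⟨K, hK, hKs⟩ := hb2.exists_le_mul_rpow (h.eventually_PsiInv_pos hc hlim)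
    ⟨0, h.PsiInv_monotoneOn hc hlim⟩ (half_pos hr).le
  have h1 : (fun s : ℝ => s ^ (-(r / 2))) =O[atTop] (fun s : ℝ => spadeInv Φ κ c (-s)) := by
    refine IsBigO.of_bound K ?_
    filter_upwards [hKs, h.eventually_PsiInv_pos hc hlim, eventually_gt_atTop 0] with s hs hp hs0
    rw [h.spadeInv_neg hc hlim hs0.le, Real.norm_of_nonneg (by positivity),
      Real.norm_of_nonneg (by positivity), Real.rpow_neg hs0.le, mul_one_div, inv_eq_one_div,
      div_le_div_iff₀ (by positivity) hp, one_mul]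
    exact hs
  exact (isLittleO_rpow_rpow_atTop (by linarith)).trans_isBigO h1

end PsiInv

theorem isRV_Psi (h : IsGauge Φ κ) (hc : c ∈ dom Φ κ) {ρ : ℝ}
    (hb : HasIndexBounds atTop (Psi Φ κ c) ρ) : IsRV (Psi Φ κ c) ρ :=
  have hc0 : 0 < 1 / c := one_div_pos.2 hc.1
  hb.isRV (a := 1 / c + 1) (by positivity)
    (fun _ ht => h.Psi_pos hc ((lt_add_one _).trans_le ht))
    ((h.Psi_strictMonoOn hc).monotoneOn.mono fun _ ht =>
      mem_psiDom_of_le (one_div_mem_psiDom hc) ((lt_add_one _).le.trans ht))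

theorem isRapid_Psi (h : IsGauge Φ κ) (hc : c ∈ dom Φ κ)
    (hb : HasRapidBounds atTop (Psi Φ κ c)) : IsRapid (Psi Φ κ c) :=
  have hc0 : 0 < 1 / c := one_div_pos.2 hc.1
  hb.isRapid (a := 1 / c + 1) (by positivity)
    (fun _ ht => h.Psi_pos hc ((lt_add_one _).trans_le ht))
    ((h.Psi_strictMonoOn hc).monotoneOn.mono fun _ ht =>
      mem_psiDom_of_le (one_div_mem_psiDom hc) ((lt_add_one _).le.trans ht))

/-! ### The range of the index -/

theorem index_nonneg (h : IsGauge Φ κ) {ρ : ℝ} (hρ : IsRVZero (fun a => Φ a κ) ρ) : 0 ≤ ρ := by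
  obtain ⟨-, -, -, -, hlim⟩ := hρ
  have h1 : (1 : ℝ) ≤ 2 ^ ρ := by
    refine ge_of_tendsto (hlim 2 two_pos) ?_
    filter_upwards [self_mem_nhdsWithin] with x (hx : 0 < x)
    rw [one_le_div (h.pos hx)]
    exact h.strictMono.monotoneOn hx.le (mul_pos two_pos hx).le (by linarith)
  by_contra! hneg
  exact (Real.rpow_lt_one_of_one_lt_of_neg one_lt_two hneg).not_ge h1

/-- If `ρ > 1`, then `1 / φ (1 / x)` outgrows `x`, by the lower Potter bound. -/
theorem index_le_one (h : IsGauge Φ κ) {ρ : ℝ} (hb : HasIndexBounds (𝓝[>] 0) (phi Φ κ) ρ)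
    (hle : ∀ᶠ t in 𝓝[>] (0 : ℝ), t ≤ phi Φ κ t) : ρ ≤ 1 := by
  by_contra! hρ
  obtain ⟨σ, hσ1, hσ⟩ := exists_between hρ
  have h2 : (0 : ℝ) < 2 ^ σ := Real.rpow_pos_of_pos two_pos σ
  have htop : Tendsto (fun t : ℝ => 1 / t) atTop (𝓝[>] 0) := by
    simpa only [one_div] using tendsto_inv_atTop_nhdsGT_zero
  have hphi := (hb.dilationBound_half hσ).le_apply_mul dilationInvariant_nhdsGT_zero two_pos h2
  have hbound : DilationBound atTop (fun x => 1 / phi Φ κ (1 / x)) 2⁻¹ (2 ^ σ)⁻¹ := by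
    filter_upwards [htop.eventually hphi, eventually_gt_atTop 0] with x hx hx0
    have h3 : 1 / (2⁻¹ * x) = 2 * (1 / x) := by field_simp
    rw [h3, ← one_div ((2 : ℝ) ^ σ), one_div_mul_one_div]
    exact one_div_le_one_div_of_le (mul_pos h2 (h.phi_pos (one_div_pos.2 hx0))) hx
  have hpos : ∀ᶠ x in atTop, 0 < 1 / phi Φ κ (1 / x) := by
    filter_upwards [eventually_gt_atTop 0] with x hx
    exact one_div_pos.2 (h.phi_pos (one_div_pos.2 hx))
  have hmono : MonotoneOn (fun x => 1 / phi Φ κ (1 / x)) (Ici 1) := by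
    intro x hx y hy hxy
    have hx0 : 0 < x := one_pos.trans_le hx
    have hy0 : 0 < y := one_pos.trans_le hy
    exact one_div_le_one_div_of_le (h.phi_pos (one_div_pos.2 hy0))
      (h.phi_strictMonoOn.monotoneOn (one_div_pos.2 hy0).le (one_div_pos.2 hx0).le
        (one_div_le_one_div_of_le hx0 hxy))
  obtain ⟨K, hK, hKx⟩ := hbound.exists_mul_rpow_le hpos ⟨1, hmono⟩ (zero_le_one.trans hσ1.le)
  have hinf : Tendsto (fun x : ℝ => K * x ^ (σ - 1)) atTop atTop :=
    (tendsto_rpow_atTop (sub_pos.2 hσ1)).const_mul_atTop hK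
  obtain ⟨x, hx1, hx2, hx3, hx0⟩ := (hKx.and ((htop.eventually hle).and
    ((hinf.eventually_gt_atTop 1).and (eventually_gt_atTop 0)))).exists
  have h4 : 1 / phi Φ κ (1 / x) ≤ x := by
    have := one_div_le_one_div_of_le (one_div_pos.2 hx0) hx2
    rwa [one_div_one_div] at this
  rw [Real.rpow_sub_one hx0.ne', mul_div_assoc', lt_div_iff₀ hx0, one_mul] at hx3
  exact (hx1.trans h4).not_gt hx3

end IsGauge

/-! ### Consistent error bounds grow at least linearly at zero -/

section ErrorBoundFunction

variable {E : Type*} [NormedAddCommGroup E] {m : ℕ} {C : Fin m → Set E}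

theorem IsConsistent.infDist_le (hΦ : IsConsistent C Φ) (hne : (⋂ i, C i).Nonempty) {x : E}
    (hx : ‖x‖ ≤ κ) : Metric.infDist x (⋂ i, C i) ≤ Φ (Metric.infDist x (⋂ i, C i)) κ := by
  have h1 : (⨆ i, Metric.infDist x (C i)) ≤ Metric.infDist x (⋂ i, C i) :=
    Real.iSup_le (fun i => Metric.infDist_le_infDist_of_subset (iInter_subset C i) hne)
      Metric.infDist_nonneg
  calc Metric.infDist x (⋂ i, C i) ≤ Φ (⨆ i, Metric.infDist x (C i)) ‖x‖ := hΦ.error_bound x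
    _ ≤ Φ (Metric.infDist x (⋂ i, C i)) ‖x‖ := hΦ.mono_left _ (norm_nonneg x)
        (Real.iSup_nonneg fun _ => Metric.infDist_nonneg) Metric.infDist_nonneg h1
    _ ≤ Φ (Metric.infDist x (⋂ i, C i)) κ := hΦ.mono_right _ Metric.infDist_nonneg
        (norm_nonneg x) ((norm_nonneg x).trans hx) hx

/-- On the segment from the point of `⋂ i, C i` nearest to `0` to `x₀`, which lies in the ball of
radius `κ`, the distance to `⋂ i, C i` takes all small values. -/
theorem IsConsistent.eventually_le_phi [InnerProductSpace ℝ E] [FiniteDimensional ℝ E]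
    (hΦ : IsConsistent C Φ) (hclosed : ∀ i, IsClosed (C i)) (hne : (⋂ i, C i).Nonempty) {x₀ : E}
    (hx₀ : x₀ ∉ ⋂ i, C i) (hκ : max (Metric.infDist 0 (⋂ i, C i)) ‖x₀‖ ≤ κ) :
    ∀ᶠ t in 𝓝[>] (0 : ℝ), t ≤ phi Φ κ t := by
  have := FiniteDimensional.proper_real E
  have hC : IsClosed (⋂ i, C i) := isClosed_iInter hclosed
  obtain ⟨p, hp, hpd⟩ := hC.exists_infDist_eq_dist hne (0 : E)
  have hpκ : p ∈ Metric.closedBall (0 : E) κ := by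
    rw [Metric.mem_closedBall, dist_comm, ← hpd]
    exact (le_max_left _ _).trans hκ
  have hxκ : x₀ ∈ Metric.closedBall (0 : E) κ := by
    rw [mem_closedBall_zero_iff]
    exact (le_max_right _ _).trans hκ
  have hd : 0 < Metric.infDist x₀ (⋂ i, C i) := (hC.notMem_iff_infDist_pos hne).1 hx₀
  have hseg : IsPreconnected (segment ℝ p x₀) := (convex_segment p x₀).isPreconnected
  have hivt := hseg.intermediate_value (left_mem_segment ℝ p x₀) (right_mem_segment ℝ p x₀)
    (Metric.continuous_infDist_pt (⋂ i, C i)).continuousOn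
  rw [Metric.infDist_zero_of_mem hp] at hivt
  filter_upwards [Ioc_mem_nhdsGT (pow_pos hd 2)] with t ht
  obtain ⟨x, hx, hxt⟩ := hivt ⟨Real.sqrt_nonneg t, (Real.sqrt_le_left hd.le).2 ht.2⟩
  have hxκ' := (convex_closedBall (0 : E) κ).segment_subset hpκ hxκ hx
  have key := hΦ.infDist_le hne (mem_closedBall_zero_iff.1 hxκ')
  simp only [hxt] at key
  calc t = √t ^ 2 := (Real.sq_sqrt ht.1.le).symm
    _ ≤ Φ (√t) κ ^ 2 := pow_le_pow_left₀ (Real.sqrt_nonneg t) key 2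

theorem pos_of_max_infDist_norm_le {s : Set E} (hs : IsClosed s) (hne : s.Nonempty) {x₀ : E}
    (hx₀ : x₀ ∉ s) (hκ : max (Metric.infDist 0 s) ‖x₀‖ ≤ κ) : 0 < κ := by
  by_contra! hκ0
  have hx : x₀ = 0 := norm_le_zero_iff.1 ((le_max_right _ _).trans (hκ.trans hκ0))
  subst hx
  exact ((hs.notMem_iff_infDist_pos hne).1 hx₀).not_ge ((le_max_left _ _).trans (hκ.trans hκ0))

end ErrorBoundFunction

end ErrorBound

theorem mainTheorem7 {E : Type*} [NormedAddCommGroup E] [InnerProductSpace ℝ E]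
    [FiniteDimensional ℝ E] {m : ℕ} (C : Fin m → Set E)
    (hclosed : ∀ i, IsClosed (C i)) (hconvex : ∀ i, Convex ℝ (C i))
    (hne : (⋂ i, C i).Nonempty)
    (Φ : ℝ → ℝ → ℝ) (hΦ : ErrorBound.IsStrictConsistent C Φ)
    (κ : ℝ) (x₀ : E) (hx₀ : x₀ ∉ ⋂ i, C i)
    (hκ : max (Metric.infDist 0 (⋂ i, C i)) ‖x₀‖ ≤ κ)
    (hcont : ContinuousOn (fun a => Φ a κ) (Ici 0))
    (ρ : ℝ) (hρ : ErrorBound.IsRVZero (fun a => Φ a κ) ρ)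
    (c : ℝ) (hc : c ∈ ErrorBound.dom Φ κ) :
    -- the inverse of `Φ_κ^♠` is well defined at `-s` for all large `s`
    (StrictMonoOn (ErrorBound.spade Φ κ c) (ErrorBound.dom Φ κ) ∧
      ∀ᶠ s in atTop, -s ∈ ErrorBound.spade Φ κ c '' ErrorBound.dom Φ κ) ∧
    -- (i)
    ρ ∈ Icc (0 : ℝ) 1 ∧
    -- (ii)
    (ρ ∈ Ioo (0 : ℝ) 1 →
      ErrorBound.IsRV (ErrorBound.Psi Φ κ c) (1 / ρ - 1) ∧
      ErrorBound.IsRV (ErrorBound.PsiInv Φ κ c) (ρ / (1 - ρ)) ∧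
      ∀ δ : ℝ, 0 < δ → 0 < ρ / (1 - ρ) - δ →
        ∃ M A : ℝ, 0 < M ∧ 0 < A ∧ ∀ s, M ≤ s →
          Real.sqrt (ErrorBound.spadeInv Φ κ c (-s)) ≤
            A * (1 / s) ^ ((ρ / (1 - ρ) - δ) / 2)) ∧
    -- (iii)
    (ρ = 1 →
      ErrorBound.IsRV (ErrorBound.Psi Φ κ c) 0 ∧
      ErrorBound.IsRapid (ErrorBound.PsiInv Φ κ c) ∧
      ∀ r : ℝ, 0 < r →
        (fun s : ℝ => Real.sqrt (ErrorBound.spadeInv Φ κ c (-s))) =o[atTop]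
          (fun s : ℝ => s ^ (-r))) ∧
    -- (iv)
    (ρ = 0 →
      ErrorBound.IsRapid (ErrorBound.Psi Φ κ c) ∧
      ErrorBound.IsRV (ErrorBound.PsiInv Φ κ c) 0 ∧
      ∀ r : ℝ, 0 < r →
        (fun s : ℝ => s ^ (-r)) =o[atTop]
          (fun s : ℝ => ErrorBound.spadeInv Φ κ c (-s))) := by
  have hC : IsClosed (⋂ i, C i) := isClosed_iInter hclosed
  have hκ0 : 0 < κ := ErrorBound.pos_of_max_infDist_norm_le hC hne hx₀ hκ
  have hle := hΦ.eventually_le_phi hclosed hne hx₀ hκ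
  have h : ErrorBound.IsGauge Φ κ := ⟨hΦ.strict κ hκ0, hcont, hΦ.map_zero κ hκ0.le⟩
  have hlim := h.tendsto_spade hc hle
  have hb := h.phi_hasIndexBounds hρ
  refine ⟨⟨h.spade_strictMonoOn hc, ?_⟩, ⟨h.index_nonneg hρ, h.index_le_one hb hle⟩, ?_, ?_, ?_⟩
  · filter_upwards [eventually_ge_atTop 0] with s hs using h.neg_mem_image_spade hc hlim hs
  · rintro ⟨hρ0, hρ1⟩
    have hσ : 0 < 1 / ρ - 1 := sub_pos.2 ((one_lt_div hρ0).2 hρ1)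
    have hσ' : 1 / (1 / ρ - 1) = ρ / (1 - ρ) := by
      rw [div_sub_one hρ0.ne', one_div_div]
    have hPsi := h.Psi_hasIndexBounds hc hlim (h.genInv_hasIndexBounds hρ0 hb)
    have hInv := h.PsiInv_hasIndexBounds hc hlim hσ hPsi
    rw [hσ'] at hInv
    exact ⟨h.isRV_Psi hc hPsi, h.isRV_PsiInv hc hlim hInv, fun δ hδ hγ =>
      h.exists_sqrt_spadeInv_le hc hlim hγ.le (hInv.dilationBound_half (sub_lt_self _ hδ))⟩
  · rintro rfl
    have hPsi := h.Psi_hasIndexBounds hc hlim (h.genInv_hasIndexBounds one_pos hb)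
    rw [one_div_one, sub_self] at hPsi
    have hInv := h.PsiInv_hasRapidBounds hc hlim hPsi
    exact ⟨h.isRV_Psi hc hPsi, h.isRapid_PsiInv hc hlim hInv, fun r hr =>
      h.sqrt_spadeInv_isLittleO hc hlim hInv hr⟩
  · rintro rfl
    have hPsi := h.Psi_hasRapidBounds hc hlim (h.genInv_hasRapidBounds hb)
    have hInv := h.PsiInv_hasIndexBounds_zero hc hlim hPsi
    exact ⟨h.isRapid_Psi hc hPsi, h.isRV_PsiInv hc hlim hInv, fun r hr =>
      h.rpow_neg_isLittleO_spadeInv hc hlim hInv hr⟩
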